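/- Let $\mathbb H=L^2([0,1])$ (real-valued functions, usual inner product $\langle\cdot,\cdot\rangle$ and norm $\|\cdot\|$). For $n\ge 1$ consider i.i.d. copies $(X_i,Y_i)_{1\le i\le n}$ of $(X,Y)$, where $Y=SX+\varepsilon$; here $X$ and $\varepsilon$ are independent centered random elements of $\mathbb H$, $\mathbb E\|X\|^2<\infty$, $\varepsilon$ is Gaussian with $\sigma_\varepsilon^2=\mathbb E\|\varepsilon\|^2$, and the unknown $S$ is an integral operator $Sf(t)=\int_0^1 \mathcal S(s,t)f(s)\,ds$ with kernel $\mathcal S\in L^2([0,1]^2)$. Let $\Gamma f=\mathbb E[\langle X,f\rangle X]$ and $\Gamma_\varepsilon f=\mathbb E[\langle \varepsilon,f\rangle \varepsilon]$ be the covariance operators. Let $(\varphi_j)_{j\ge1}$ be an orthonormal basis of $\mathbb H$ with $\Gamma\varphi_j=\lambda_j\varphi_j$, where $\lambda_1\ge\lambda_2\ge\cdots$ and $\lambda_j>0$ for all $j$. Assume that $\varphi_1$ lies in the range of $\Gamma_\varepsilon^{1/2}$, and let $\sigma_1>0$ be such that $\varphi_1=\Gamma_\varepsilon^{1/2}w$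 for some $w\in\mathbb H$ with $\|w\|^2\le 1/\sigma_1$ (that is, $\|\Gamma_\varepsilon^{-1/2}\varphi_1\|^2\le 1/\sigma_1$). Let $\alpha,\beta,R>0$, and let $(\eta_\alpha(j))_{j\ge1}$, $(\psi_\beta(j))_{j\ge1}$ be real sequences with $\eta_\alpha(j)\asymp j^\alpha$ or $\eta_\alpha(j)\asymp \exp(j^\alpha)$, and $\psi_\beta(j)\asymp j^\beta$ or $\psi_\beta(j)\asymp\exp(j^\beta)$, where $a_j\asymp b_j$ means that there is $c\ge1$ with $c^{-1}a_j\le b_j\le c\,a_j$ for all $j\ge 1$. Let $$\mathcal W_{\alpha,\beta}^R=\Big\{T \text{ Hilbert--Schmidt on }\mathbb H:\ \sum_{j\ge1}\sum_{r\ge1}\eta_\alpha(j)\,\psi_\beta(r)\,\langle T\varphi_j,\varphi_r\rangle^2\le R^2\Big\}.$$ For an estimator $\widehat S_n$ (a measurable function of the sample $(X_i,Y_i)_{i\le n}$ with values in the bounded operators on $\mathbb H$) let $\mathrm{MSPE}(\widehat S_n)=\mathbb E\|\widehat S_n(X_{n+1})-S(X_{n+1})\|^2$, where $X_{n+1}$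 is a copy of $X$ independent of the sample. Then there is a constant $C>0$, depending only on $\alpha,\beta,R,\sigma_1,\sigma_\varepsilon^2$ and the sequences $\eta_\alpha,\psi_\beta$ (and not on $n$, nor otherwise on the laws of $X$ and $\varepsilon$), such that for every $n\ge1$ $$\inf_{\widehat S_n}\ \sup_{S\Gamma^{1/2}\in\mathcal W_{\alpha,\beta}^R}\mathrm{MSPE}(\widehat S_n)\ \ge\ C\inf_{m_1\in\mathbb N\setminus\{0\}}\Big\{\sigma_\varepsilon^2\,\frac{m_1}{n}+\frac{3}{\eta_\alpha(m_1)}\Big\},$$ where the infimum on the left is over all estimators and the supremum over all $S$ as above with $S\Gamma^{1/2}\in\mathcal W_{\alpha,\beta}^R$. -/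

import Mathlib

open MeasureTheory ProbabilityTheory
open scoped ENNReal RealInnerProductSpace

noncomputable section

/-! ### The Hilbert space `L²([0,1])` and operators on it -/

/-- Lebesgue measure on `[0,1]`. -/
def leb01 : Measure ℝ := volume.restrict (Set.Icc (0 : ℝ) 1)

/-- The real Hilbert space `L²([0,1])`. -/
abbrev L201 : Type := Lp ℝ 2 leb01

/-- `L²([0,1])` carries its Borel σ-algebra. -/
instance instMeasurableSpaceL201 : MeasurableSpace L201 := borel L201

instance instBorelSpaceL201 : BorelSpace L201 := ⟨rfl⟩

/-- `S` is an integral operator with square integrable kernel `k`: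
`(S f)(t) = ∫₀¹ k(s, t) f(s) ds`. -/
def IsL2IntegralOperator (S : L201 →L[ℝ] L201) : Prop :=
  ∃ k : ℝ × ℝ → ℝ, MemLp k 2 (leb01.prod leb01) ∧
    ∀ f : L201, ∀ᵐ t ∂leb01, S f t = ∫ s, k (s, t) * f s ∂leb01

/-- `T` is Hilbert–Schmidt: `∑ ‖T (b j)‖² < ∞` for some (equivalently, for every) Hilbert basis
`b`. -/
def IsHilbertSchmidt (T : L201 →L[ℝ] L201) : Prop :=
  ∃ b : HilbertBasis ℕ+ ℝ L201, Summable fun j => ‖T (b j)‖ ^ 2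

/-- `G` is a positive square root of `A`. -/
def IsPosSqrt (A G : L201 →L[ℝ] L201) : Prop :=
  G.IsPositive ∧ G ∘L G = A

open Classical in
/-- The positive square root `A ^ (1/2)` of a positive operator `A`
(by convention `0` when `A` has no positive square root, i.e. when `A` is not positive). -/
def opSqrt (A : L201 →L[ℝ] L201) : L201 →L[ℝ] L201 :=
  if h : ∃ G, IsPosSqrt A G then h.choose else 0

/-- A positive square root of `A` acts on an eigenvector of `A` for the eigenvalue `l`
as multiplication by `√l`. -/
theorem IsPosSqrt.apply_eigenvector {A G : L201 →L[ℝ] L201} (hG : IsPosSqrt A G) {l : ℝ}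
    (hl : 0 ≤ l) {x : L201} (hx : A x = l • x) : G x = Real.sqrt l • x := by
  obtain ⟨hpos, hsq⟩ := hG
  have hGG : G (G x) = l • x := by
    rw [← hx, ← hsq]; rfl
  have hll : Real.sqrt l * Real.sqrt l = l := Real.mul_self_sqrt hl
  rcases eq_or_lt_of_le (Real.sqrt_nonneg l) with h0 | h0
  · have hl0 : l = 0 := by rw [← hll, ← h0]; simp
    have h1 : ⟪G x, G x⟫ = 0 := by
      have h2 := hpos.isSymmetric (G x) x
      have h3 : ⟪G (G x), x⟫ = ⟪G x, G x⟫ := h2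
      rw [← h3, hGG, hl0]; simp
    rw [← h0, zero_smul]
    exact inner_self_eq_zero.1 h1
  · set u := G x - Real.sqrt l • x with hu
    have h1 : G u = -(Real.sqrt l • u) := by
      rw [hu, map_sub, map_smul, hGG, smul_sub, smul_smul, hll]; abel
    have h2 : 0 ≤ ⟪G u, u⟫ := hpos.inner_nonneg_left u
    rw [h1, inner_neg_left, real_inner_smul_left] at h2
    have h3 : ⟪u, u⟫ ≤ 0 := by
      by_contra hcon
      have := mul_pos h0 (not_le.1 hcon)
      linarith
    exact sub_eq_zero.1 (inner_self_eq_zero.1 (le_antisymm h3 real_inner_self_nonneg))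

/-- An operator that is diagonal in a Hilbert basis, with nonnegative eigenvalues, has a positive
square root. -/
theorem exists_isPosSqrt {A : L201 →L[ℝ] L201} (b : HilbertBasis ℕ+ ℝ L201) (l : ℕ+ → ℝ)
    (hl : ∀ j, 0 ≤ l j) (hA : ∀ j, A (b j) = l j • b j) : ∃ G, IsPosSqrt A G := by
  have hbd : ∀ j, Real.sqrt (l j) ≤ Real.sqrt ‖A‖ := fun j => by
    apply Real.sqrt_le_sqrt
    have h1 : ‖A (b j)‖ ≤ ‖A‖ * ‖b j‖ := A.le_opNorm _
    have h2 : ‖b j‖ = 1 := b.orthonormal.1 j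
    rw [hA, norm_smul, h2, mul_one, mul_one, Real.norm_of_nonneg (hl j)] at h1
    exact h1
  have hmem : ∀ f : lp (fun _ : ℕ+ => ℝ) 2, Memℓp (fun j => Real.sqrt (l j) * f j) 2 := fun f => by
    apply memℓp_gen
    have hf := (lp.memℓp f).summable (by norm_num)
    refine Summable.of_nonneg_of_le (fun j => by positivity) (fun j => ?_)
      (hf.mul_left (Real.sqrt ‖A‖ ^ (2 : ℝ≥0∞).toReal))
    rw [norm_mul, Real.norm_of_nonneg (Real.sqrt_nonneg _),
      Real.mul_rpow (Real.sqrt_nonneg _) (norm_nonneg _)]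
    have := hbd j
    gcongr
  let D : lp (fun _ : ℕ+ => ℝ) 2 →ₗ[ℝ] lp (fun _ : ℕ+ => ℝ) 2 :=
    { toFun := fun f => ⟨fun j => Real.sqrt (l j) * f j, hmem f⟩
      map_add' := fun f g => by
        ext j
        exact mul_add (Real.sqrt (l j)) (f j) (g j)
      map_smul' := fun c f => by
        ext j
        exact mul_left_comm (Real.sqrt (l j)) c (f j) }
  have hD : ∀ f j, D f j = Real.sqrt (l j) * f j := fun f j => rfl
  have hDbd : ∀ f, ‖D f‖ ≤ Real.sqrt ‖A‖ * ‖f‖ := fun f => by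
    have hp : 0 < (2 : ℝ≥0∞).toReal := by norm_num
    refine lp.norm_le_of_forall_sum_le hp (by positivity) fun s => ?_
    rw [Real.mul_rpow (Real.sqrt_nonneg _) (norm_nonneg _)]
    calc ∑ i ∈ s, ‖D f i‖ ^ (2 : ℝ≥0∞).toReal
        ≤ ∑ i ∈ s, Real.sqrt ‖A‖ ^ (2 : ℝ≥0∞).toReal * ‖f i‖ ^ (2 : ℝ≥0∞).toReal := by
          refine Finset.sum_le_sum fun i _ => ?_
          rw [hD, norm_mul, Real.norm_of_nonneg (Real.sqrt_nonneg _),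
            Real.mul_rpow (Real.sqrt_nonneg _) (norm_nonneg _)]
          have := hbd i
          gcongr
      _ ≤ _ := by
          rw [← Finset.mul_sum]
          gcongr
          exact lp.sum_rpow_le_norm_rpow hp f s
  let Dc := D.mkContinuous _ hDbd
  let G : L201 →L[ℝ] L201 :=
    (b.repr.symm.toContinuousLinearEquiv : _ →L[ℝ] L201) ∘L Dc ∘L
      (b.repr.toContinuousLinearEquiv : L201 →L[ℝ] _)
  have hGr : ∀ x, b.repr (G x) = D (b.repr x) := fun x => by simp [G, Dc]
  have hAr : ∀ x j, b.repr (A x) j = l j * b.repr x j := by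
    intro x j
    have hclosed : (A : L201 →L[ℝ] L201) = G ∘L G := by
      apply ContinuousLinearMap.ext_on (s := Set.range b)
      · have := b.dense_span
        rw [Submodule.dense_iff_topologicalClosure_eq_top]
        exact this
      · rintro _ ⟨i, rfl⟩
        apply b.repr.injective
        rw [hA, ContinuousLinearMap.comp_apply, hGr, hGr, map_smul, b.repr_self]
        ext k
        rw [hD, hD, ← mul_assoc, Real.mul_self_sqrt (hl k)]
        by_cases hk : k = i
        · subst hk; simp
        · simp [lp.single_apply, hk]
    rw [hclosed, ContinuousLinearMap.comp_apply, hGr, hGr, hD, hD, ← mul_assoc,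
      Real.mul_self_sqrt (hl j)]
  refine ⟨G, ?_, ?_⟩
  · rw [ContinuousLinearMap.isPositive_iff]
    refine ⟨fun x y => ?_, fun x => ?_⟩
    · change ⟪G x, y⟫ = ⟪x, G y⟫
      rw [← b.repr.inner_map_map, ← b.repr.inner_map_map x, hGr, hGr, lp.inner_eq_tsum,
        lp.inner_eq_tsum]
      refine tsum_congr fun j => ?_
      simp only [hD, RCLike.inner_apply, conj_trivial]
      ring
    · rw [← b.repr.inner_map_map, hGr, lp.inner_eq_tsum]
      refine tsum_nonneg fun j => ?_
      simp only [hD, RCLike.inner_apply, conj_trivial]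
      have := Real.sqrt_nonneg (l j)
      nlinarith [mul_nonneg this (mul_self_nonneg (b.repr x j))]
  · ext1 x
    apply b.repr.injective
    ext j
    rw [ContinuousLinearMap.comp_apply, hGr, hGr, hD, hD, ← mul_assoc, Real.mul_self_sqrt (hl j),
      hAr]

/-- If `A` is diagonal in a Hilbert basis, with nonnegative eigenvalues `l j`, then `opSqrt A` is
the positive square root of `A`, and it is diagonal in the same basis with eigenvalues
`√(l j)`. -/
theorem opSqrt_spec {A : L201 →L[ℝ] L201} (b : HilbertBasis ℕ+ ℝ L201) (l : ℕ+ → ℝ)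
    (hl : ∀ j, 0 ≤ l j) (hA : ∀ j, A (b j) = l j • b j) :
    IsPosSqrt A (opSqrt A) ∧ ∀ j, opSqrt A (b j) = Real.sqrt (l j) • b j := by
  have h := exists_isPosSqrt b l hl hA
  have hs : IsPosSqrt A (opSqrt A) := by
    rw [opSqrt, dif_pos h]; exact h.choose_spec
  exact ⟨hs, fun j => hs.apply_eigenvector (hl j) (hA j)⟩

/-! ### Regularity sequences and ellipsoids -/

/-- `a ≍ b`: there is `c ≥ 1` with `c⁻¹ a_j ≤ b_j ≤ c a_j` for all `j ≥ 1`. -/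
def SeqEquiv (a b : ℕ+ → ℝ) : Prop :=
  ∃ c : ℝ, 1 ≤ c ∧ ∀ j, c⁻¹ * a j ≤ b j ∧ b j ≤ c * a j

/-- `a_j ≍ j ^ γ` (polynomial case) or `a_j ≍ exp (j ^ γ)` (exponential case). -/
def IsRegularitySeq (γ : ℝ) (a : ℕ+ → ℝ) : Prop :=
  SeqEquiv a (fun j => ((j : ℕ) : ℝ) ^ γ) ∨ SeqEquiv a (fun j => Real.exp (((j : ℕ) : ℝ) ^ γ))

/-- The ellipsoid of Hilbert–Schmidt operators `T` with
`∑_j ∑_r η_j ψ_r ⟨T φ_j, φ_r⟩² ≤ R²`. -/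
def ellipsoid (φ : HilbertBasis ℕ+ ℝ L201) (η ψ : ℕ+ → ℝ) (R : ℝ) : Set (L201 →L[ℝ] L201) :=
  {T | IsHilbertSchmidt T ∧
    ∑' j, ∑' r, ENNReal.ofReal (η j * ψ r * ⟪T (φ j), φ r⟫ ^ 2) ≤ ENNReal.ofReal (R ^ 2)}

/-! ### The functional linear model, estimators, and the prediction risk -/

/-- The law of `(X, Y)` with `Y = S X + ε`, where `X` has law `μX` and `ε`, independent of `X`, has
law `με`. -/
def modelLaw (μX με : Measure L201) (S : L201 →L[ℝ] L201) : Measure (L201 × L201) :=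
  (μX.prod με).map fun p => (p.1, S p.1 + p.2)

/-- An estimator of the slope operator: an operator-valued function of the sample
`((X_i, Y_i))_{i < n}`, measurable in the sense that its value at every fixed `x` is measurable. -/
structure SlopeEstimator (n : ℕ) where
  /-- the value of the estimator at a sample -/
  toFun : (Fin n → L201 × L201) → (L201 →L[ℝ] L201)
  measurable_apply : ∀ x : L201, Measurable fun d => toFun d x

/-- The mean square prediction error `𝔼 ‖Ŝ X_{n+1} - S X_{n+1}‖²`, where `Ŝ` is computed from `n`
independent copies of `(X, Y)` and `X_{n+1}` is a further independent copy of `X`. -/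
def mspe (μX με : Measure L201) (n : ℕ) (Shat : SlopeEstimator n) (S : L201 →L[ℝ] L201) : ℝ≥0∞ :=
  ∫⁻ d, ∫⁻ x, ‖Shat.toFun d x - S x‖ₑ ^ 2 ∂μX ∂(Measure.pi fun _ : Fin n => modelLaw μX με S)

/-- The minimax prediction risk over the integral operators `S` with `S Γ^{1/2}` in the class `W`,
where `Γ` is the covariance operator of `X`. -/
def minimaxMSPE (μX με : Measure L201) (n : ℕ) (W : Set (L201 →L[ℝ] L201)) : ℝ≥0∞ :=
  ⨅ Shat : SlopeEstimator n,
    ⨆ S ∈ {S : L201 →L[ℝ] L201 |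
      IsL2IntegralOperator S ∧ S ∘L opSqrt (covarianceOperator μX) ∈ W},
    mspe μX με n Shat S

end

/-!
The lower bound is already attained in the submodel of rank-one slope operators
`S = ⟪g, ·⟫ φ₁`, with `g` in a hypercube; it is Assouad's argument.

*Noise.* Since `φ₁ = Γ_ε^{1/2} w`, the noise splits as `ε = y φ₁ + e` in law, where `y` is a real
centred Gaussian variable with variance `v ≥ 1 / ‖w‖² ≥ σ₁`, independent of `e`
(`exists_gaussian_splitting`). The splitting is the decomposition of `ε` along the Paley–Wiener
functional of `w` (`exists_paleyWiener`), and it is verified on characteristic functions. Given the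
inputs `x_i` and the components `e_i`, the sample of the submodel is thus a function of a Gaussian
vector with mean `(⟪g, x_i⟫)_i` and covariance `v • 1` (`lintegral_pi_modelLaw`).

*Two points.* For two Gaussian vectors with the same covariance, the densities with respect to the
Gaussian vector centred at the midpoint have a constant product. This gives a lower bound for the sum
of the two squared errors of any statistic (`two_point_sq_bound`) that is affine in the squared
distance of the means, and can be averaged over the inputs (`two_point_sq_bound_modelLaw`).

*Hypercube.* For `g = ∑ ± δ λ_j^{-1/2} φ_j`, `j ≤ M`, the prediction error dominates
`∑_{j ≤ M} λ_j ⟪(Ŝ - S) φ_j, φ₁⟫²` (`sum_le_lintegral_enorm_apply_sq`). Each of these terms is of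
order `δ²` on average over an edge of the cube as soon as `n δ² ≤ v / 2`, so that the minimax risk is
at least `M δ² / 2` (`le_minimaxMSPE_of_hypercube`). The cube lies in the ellipsoid if
`ψ₁ δ² ∑_{j ≤ M} η_j ≤ R²`, and `∑_{j ≤ M} η_j ≲ M η_M`.

*Balance.* Choose `M` maximal with `M η_M ≲ n` (`exists_balanced_dimension`) and `δ²` a multiple of
`1 / n`. The bound is then a multiple of `M / n`, and so is the value of the infimum in the theorem.
-/

/-! ### Splitting a Gaussian measure along a Cameron–Martin direction -/

section GaussianSplitting

open Filter Topology Complex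

variable {E : Type*} [NormedAddCommGroup E] [InnerProductSpace ℝ E] [CompleteSpace E]
  [SecondCountableTopology E] [MeasurableSpace E] [BorelSpace E]

theorem charFun_eq_exp_covarianceOperator (μ : Measure E) [IsGaussian μ]
    (hμ0 : ∫ e, e ∂μ = 0) (t : E) :
    charFun μ t = cexp (-((⟪covarianceOperator μ t, t⟫ / 2 : ℝ) : ℂ)) := by
  have h2 : MemLp id 2 μ := IsGaussian.memLp_two_id
  rw [IsGaussian.charFun_eq', covarianceBilin_apply h2, covarianceOperator_inner h2]
  simp [hμ0]

/-- Characteristic functionals `∫ exp (i f)` depend continuously on `f` in mean. -/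
theorem tendsto_integral_exp_mul_I {Ω : Type*} [MeasurableSpace Ω] {μ : Measure Ω}
    [IsProbabilityMeasure μ] {f : ℕ → Ω → ℝ} {g : Ω → ℝ} (hf : ∀ k, AEStronglyMeasurable (f k) μ)
    (hg : AEStronglyMeasurable g μ)
    (h : Tendsto (fun k => eLpNorm (f k - g) 1 μ) atTop (𝓝 0)) :
    Tendsto (fun k => ∫ x, cexp (f k x * I) ∂μ) atTop (𝓝 (∫ x, cexp (g x * I) ∂μ)) := by
  have hint : ∀ u : Ω → ℝ, AEStronglyMeasurable u μ → Integrable (fun x => cexp (u x * I)) μ :=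
    fun u hu => Integrable.of_bound
      ((by fun_prop : Continuous fun r : ℝ => cexp (r * I)).comp_aestronglyMeasurable hu) 1
      (Eventually.of_forall fun x => by rw [Complex.norm_exp_ofReal_mul_I])
  refine tendsto_integral_of_L1 _ (hint g hg).1
    (Eventually.of_forall fun k => hint _ (hf k)) ?_
  refine tendsto_of_tendsto_of_tendsto_of_le_of_le tendsto_const_nhds h (fun _ => zero_le)
    fun k => ?_
  rw [eLpNorm_one_eq_lintegral_enorm]
  refine lintegral_mono fun x => ?_
  have h1 : cexp (f k x * I) - cexp (g x * I)
      = cexp (g x * I) * (cexp (I * ((f k x - g x : ℝ) : ℂ)) - 1) := by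
    rw [mul_sub, ← Complex.exp_add, mul_one]
    congr 2
    push_cast
    ring
  have h2 : ‖cexp (f k x * I) - cexp (g x * I)‖ ≤ ‖f k x - g x‖ := by
    rw [h1, norm_mul, Complex.norm_exp_ofReal_mul_I, one_mul]
    exact Real.norm_exp_I_mul_ofReal_sub_one_le
  simpa [enorm_le_iff_norm_le] using h2

/-- The Paley–Wiener functional `ℓ` attached to `w`: the limit in `L²(μ)` of the linear functionals
`⟪v k, ·⟫` with `G (v k) → w`. It is jointly Gaussian with the continuous linear functionals. -/
theorem exists_paleyWiener (μ : Measure E) [IsGaussian μ] (hμ0 : ∫ e, e ∂μ = 0) {G : E →L[ℝ] E}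
    (hG : G.IsPositive) (hGG : G ∘L G = covarianceOperator μ) {w : E}
    (hw : w ∈ closure (Set.range G)) :
    ∃ l : E → ℝ, Measurable l ∧ ∀ (t : E) (c : ℝ),
      ∫ e, cexp ((⟪e, t⟫ + c * l e : ℝ) * I) ∂μ =
        cexp (-((‖G t + c • w‖ ^ 2 / 2 : ℝ) : ℂ)) := by
  have h2 : MemLp id 2 μ := IsGaussian.memLp_two_id
  have hsq : ∀ u, ⟪covarianceOperator μ u, u⟫ = ‖G u‖ ^ 2 := fun u => by
    rw [← hGG, ContinuousLinearMap.comp_apply, ← real_inner_self_eq_norm_sq]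
    exact hG.isSymmetric (G u) u
  obtain ⟨x, hx, hxw⟩ := mem_closure_iff_seq_limit.1 hw
  choose v hv using hx
  have hmem : ∀ u : E, MemLp (fun e => ⟪u, e⟫) 2 μ := fun u => h2.const_inner u
  let J : E → Lp ℝ 2 μ := fun u => (hmem u).toLp
  have hJ : ∀ u, ‖J u‖ = ‖G u‖ := fun u => by
    have h3 : ‖J u‖ ^ 2 = ‖G u‖ ^ 2 := by
      rw [← hsq, covarianceOperator_inner h2, ← real_inner_self_eq_norm_sq, L2.inner_def]
      refine integral_congr_ae ?_
      filter_upwards [(hmem u).coeFn_toLp] with e he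
      simp only [J, he, RCLike.inner_apply, conj_trivial]
    exact (sq_eq_sq₀ (norm_nonneg _) (norm_nonneg _)).1 h3
  have hJsub : ∀ u u', J u - J u' = J (u - u') := fun u u' => by
    rw [← MemLp.toLp_sub]
    refine MemLp.toLp_congr _ _ (Eventually.of_forall fun e => ?_)
    simp [inner_sub_left]
  have hcau : CauchySeq fun k => J (v k) := by
    have hc := hxw.cauchySeq
    rw [Metric.cauchySeq_iff] at hc ⊢
    intro ε hε
    obtain ⟨N, hN⟩ := hc ε hε
    refine ⟨N, fun m hm n hn => ?_⟩
    have := hN m hm n hn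
    rwa [dist_eq_norm, ← hv m, ← hv n, ← map_sub, ← hJ, ← hJsub, ← dist_eq_norm] at this
  obtain ⟨l, hl⟩ := cauchySeq_tendsto_of_complete hcau
  have hlm : Measurable (l : E → ℝ) := (Lp.stronglyMeasurable l).measurable
  refine ⟨l, hlm, fun t c => ?_⟩
  have hlim1 : Tendsto (fun k => ∫ e, cexp ((⟪e, t⟫ + c * ⟪v k, e⟫ : ℝ) * I) ∂μ) atTop
      (𝓝 (∫ e, cexp ((⟪e, t⟫ + c * l e : ℝ) * I) ∂μ)) := by
    refine tendsto_integral_exp_mul_I (f := fun k e => ⟪e, t⟫ + c * ⟪v k, e⟫)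
      (g := fun e => ⟪e, t⟫ + c * l e) (fun k => ?_) ?_ ?_
    · exact Measurable.aestronglyMeasurable (by fun_prop)
    · exact Measurable.aestronglyMeasurable (by fun_prop)
    have h3 : Tendsto (fun k => eLpNorm ((fun e => ⟪v k, e⟫) - (l : E → ℝ)) 2 μ) atTop (𝓝 0) := by
      have h4 := (Lp.tendsto_Lp_iff_tendsto_eLpNorm' _ _).1 hl
      refine h4.congr fun k => eLpNorm_congr_ae ?_
      filter_upwards [(hmem (v k)).coeFn_toLp] with e he
      simp only [Pi.sub_apply, J, he]
    have h5 : Tendsto (fun k => ENNReal.ofReal |c| *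
        eLpNorm ((fun e => ⟪v k, e⟫) - (l : E → ℝ)) 2 μ) atTop (𝓝 0) := by
      simpa using ENNReal.Tendsto.const_mul h3 (Or.inr ENNReal.ofReal_ne_top)
    refine tendsto_of_tendsto_of_tendsto_of_le_of_le tendsto_const_nhds h5 (fun _ => zero_le)
      fun k => ?_
    have h6 : (fun e => ⟪e, t⟫ + c * ⟪v k, e⟫) - (fun e => ⟪e, t⟫ + c * l e)
        = c • ((fun e => ⟪v k, e⟫) - (l : E → ℝ)) := by
      ext e
      simp only [Pi.sub_apply, Pi.smul_apply, smul_eq_mul]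
      ring
    change eLpNorm ((fun e => ⟪e, t⟫ + c * ⟪v k, e⟫) - (fun e => ⟪e, t⟫ + c * l e)) 1 μ ≤ _
    rw [h6, eLpNorm_const_smul, Real.enorm_eq_ofReal_abs]
    gcongr
    refine eLpNorm_le_eLpNorm_of_exponent_le (by norm_num) ?_
    exact Measurable.aestronglyMeasurable (by fun_prop)
  have heq : ∀ k, ∫ e, cexp ((⟪e, t⟫ + c * ⟪v k, e⟫ : ℝ) * I) ∂μ
      = cexp (-((‖G t + c • x k‖ ^ 2 / 2 : ℝ) : ℂ)) := fun k => by
    have h7 := charFun_eq_exp_covarianceOperator μ hμ0 (t + c • v k)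
    rw [hsq, map_add, map_smul, hv, charFun_apply] at h7
    rw [← h7]
    simp only [inner_add_right, inner_smul_right, real_inner_comm]
  have hlim2 : Tendsto (fun k => cexp (-((‖G t + c • x k‖ ^ 2 / 2 : ℝ) : ℂ))) atTop
      (𝓝 (cexp (-((‖G t + c • w‖ ^ 2 / 2 : ℝ) : ℂ)))) := by
    have hcont : Continuous fun y : E => cexp (-((‖G t + c • y‖ ^ 2 / 2 : ℝ) : ℂ)) := by fun_prop
    exact (hcont.tendsto w).comp hxw
  simp_rw [heq] at hlim1
  exact tendsto_nhds_unique hlim1 hlim2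

/-- A centred Gaussian measure `μ` with covariance `G ∘ G` is the law of `y h + e`, where
`h = G w ≠ 0`, the real variable `y` is centred Gaussian with variance at least `1 / ‖w‖²`, and `e`
is independent of `y`. -/
theorem exists_gaussian_splitting (μ : Measure E) [IsGaussian μ] (hμ0 : ∫ e, e ∂μ = 0)
    {G : E →L[ℝ] E} (hG : G.IsPositive) (hGG : G ∘L G = covarianceOperator μ) {w : E}
    (hw : G w ≠ 0) :
    ∃ (v : NNReal) (ν : Measure E), IsProbabilityMeasure ν ∧ 1 ≤ v * ‖w‖ ^ 2 ∧
      μ = (ν.prod (gaussianReal 0 v)).map fun p => p.2 • G w + p.1 := by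
  -- Only the component of `w` in the closure of the range of `G` is a limit of vectors `G v`;
  -- the orthogonal component is in the kernel of `G`.
  let K : Submodule ℝ E := (LinearMap.range G.toLinearMap).topologicalClosure
  have : CompleteSpace K := (Submodule.isClosed_topologicalClosure _).completeSpace_coe
  set w' : E := K.starProjection w with hw'
  have hGw' : G w' = G w := by
    have h1 : w - w' ∈ Kᗮ := Submodule.sub_starProjection_mem_orthogonal w
    have h2 : G (w - w') = 0 := by
      rw [← inner_self_eq_zero (𝕜 := ℝ)]
      have h3 : ⟪G (w - w'), G (w - w')⟫ = ⟪G (G (w - w')), w - w'⟫ :=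
        (hG.isSymmetric (G (w - w')) (w - w')).symm
      rw [h3]
      exact (Submodule.mem_orthogonal _ _).1 h1 _
        (Submodule.le_topologicalClosure _ ⟨G (w - w'), rfl⟩)
    rw [map_sub, sub_eq_zero] at h2
    exact h2.symm
  have hw'mem : w' ∈ closure (Set.range G) := by
    have hK : w' ∈ (K : Set E) := Submodule.starProjection_apply_mem _ _
    rwa [Submodule.topologicalClosure_coe, LinearMap.coe_range] at hK
  have hw'norm : ‖w'‖ ≤ ‖w‖ := K.norm_starProjection_apply_le w
  have hw'0 : 0 < ‖w'‖ := by
    rw [norm_pos_iff]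
    rintro h0
    rw [h0, map_zero] at hGw'
    exact hw hGw'.symm
  obtain ⟨l, hlm, hl⟩ := exists_paleyWiener μ hμ0 hG hGG hw'mem
  set h : E := G w with hh
  set s : ℝ := ‖w'‖ ^ 2 with hs
  have hs0 : 0 < s := by positivity
  have hmeas : Measurable fun e => e - (l e / s) • h := by fun_prop
  refine ⟨⟨s⁻¹, by positivity⟩, μ.map fun e => e - (l e / s) • h,
    Measure.isProbabilityMeasure_map hmeas.aemeasurable, ?_, ?_⟩
  · change 1 ≤ s⁻¹ * ‖w‖ ^ 2
    rw [inv_mul_eq_div, one_le_div hs0, hs]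
    gcongr
  have : IsProbabilityMeasure (μ.map fun e => e - (l e / s) • h) :=
    Measure.isProbabilityMeasure_map hmeas.aemeasurable
  set v : NNReal := ⟨s⁻¹, by positivity⟩ with hv
  have hmeas2 : Measurable fun p : E × ℝ => p.2 • h + p.1 := by fun_prop
  have : IsProbabilityMeasure (((μ.map fun e => e - (l e / s) • h).prod
      (gaussianReal 0 v)).map fun p => p.2 • h + p.1) :=
    Measure.isProbabilityMeasure_map hmeas2.aemeasurable
  refine Measure.ext_of_charFun (funext fun t => ?_)
  have hexp : ∀ p : E × ℝ, cexp (⟪p.2 • h + p.1, t⟫ * I)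
      = cexp (⟪p.1, t⟫ * I) * cexp (⟪h, t⟫ * p.2 * I) := fun p => by
    rw [← Complex.exp_add, inner_add_left, real_inner_smul_left]
    congr 1
    push_cast
    ring
  rw [charFun_apply, charFun_apply, integral_map hmeas2.aemeasurable (by fun_prop)]
  simp_rw [hexp]
  rw [integral_prod_mul (fun e : E => cexp (⟪e, t⟫ * I)) (fun y : ℝ => cexp (⟪h, t⟫ * y * I)),
    ← charFun_apply_real, charFun_gaussianReal, integral_map hmeas.aemeasurable (by fun_prop)]
  have h1 := hl t 0
  have h2 := hl t (-(⟪h, t⟫ / s))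
  have h3 : ∀ e, cexp (⟪e - (l e / s) • h, t⟫ * I)
      = cexp ((⟪e, t⟫ + -(⟪h, t⟫ / s) * l e : ℝ) * I) := fun e => by
    rw [inner_sub_left, real_inner_smul_left]
    congr 3
    ring
  simp_rw [h3]
  rw [h2, ← Complex.exp_add]
  simp only [zero_mul, add_zero, zero_smul] at h1
  rw [h1]
  congr 1
  have h4 : ⟪G t, w'⟫ = ⟪h, t⟫ := by
    rw [← hGw', real_inner_comm t]
    exact hG.isSymmetric t w'
  have h5 : ‖G t + (-(⟪h, t⟫ / s)) • w'‖ ^ 2 = ‖G t‖ ^ 2 - ⟪h, t⟫ ^ 2 / s := by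
    rw [norm_add_sq_real, inner_smul_right, h4, norm_smul, mul_pow, ← hs, Real.norm_eq_abs, sq_abs]
    field_simp
    ring
  rw [h5]
  have hvs : ((v : ℝ) : ℂ) = ((s⁻¹ : ℝ) : ℂ) := rfl
  rw [hvs]
  push_cast
  ring

end GaussianSplitting

/-! ### A two-point bound for the squared error -/

section TwoPoint

/-- **Two-point bound.** If `P` and `Q` have densities `p` and `q` whose product is a constant `ρ`,
no statistic `T` estimates well both the value `a` under `P` and the value `a'` under `Q`. -/
theorem two_point_sq_bound {Ω : Type*} [MeasurableSpace Ω] {μ : Measure Ω} [IsProbabilityMeasure μ]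
    {p q : Ω → ℝ} (hp : Measurable p) (hq : Measurable q) (hp0 : ∀ x, 0 < p x)
    (hq0 : ∀ x, 0 < q x) {ρ : ℝ} (hpq : ∀ x, p x * q x = ρ)
    (hP : IsProbabilityMeasure (μ.withDensity fun x => ENNReal.ofReal (p x)))
    (hQ : IsProbabilityMeasure (μ.withDensity fun x => ENNReal.ofReal (q x)))
    {T : Ω → ℝ} (hT : Measurable T) (a a' : ℝ) :
    ENNReal.ofReal ((a - a') ^ 2 / 2 * ρ) ≤
      ∫⁻ x, ENNReal.ofReal ((T x - a) ^ 2) ∂(μ.withDensity fun x => ENNReal.ofReal (p x)) +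
      ∫⁻ x, ENNReal.ofReal ((T x - a') ^ 2) ∂(μ.withDensity fun x => ENNReal.ofReal (q x)) := by
  obtain ⟨x₀⟩ : Nonempty Ω := μ.nonempty_of_neZero
  have hρ : 0 < ρ := hpq x₀ ▸ mul_pos (hp0 x₀) (hq0 x₀)
  have hp1 : ∫⁻ x, ENNReal.ofReal (p x) ∂μ = 1 := by
    have := hP.measure_univ
    rwa [withDensity_apply _ MeasurableSet.univ, Measure.restrict_univ] at this
  have hq1 : ∫⁻ x, ENNReal.ofReal (q x) ∂μ = 1 := by
    have := hQ.measure_univ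
    rwa [withDensity_apply _ MeasurableSet.univ, Measure.restrict_univ] at this
  rw [lintegral_withDensity_eq_lintegral_mul _ (by fun_prop) (by fun_prop),
    lintegral_withDensity_eq_lintegral_mul _ (by fun_prop) (by fun_prop)]
  simp only [Pi.mul_apply]
  set D := (a - a') ^ 2 * ρ with hD
  have hD0 : 0 ≤ D := by positivity
  -- `A² p + B² q ≥ (A - B)² p q / (p + q)`, and `1 / s ≥ 1 - s / 4` with `s = p + q`.
  have hpt : ∀ x, D ≤ p x * (T x - a) ^ 2 + q x * (T x - a') ^ 2 + (D / 4 * p x + D / 4 * q x) := by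
    intro x
    have hs : 0 < p x + q x := add_pos (hp0 x) (hq0 x)
    have h1 : (a - a') ^ 2 * (p x * q x) ≤
        (p x * (T x - a) ^ 2 + q x * (T x - a') ^ 2) * (p x + q x) := by
      nlinarith [sq_nonneg (p x * (T x - a) + q x * (T x - a'))]
    rw [hpq, ← hD] at h1
    have h2 : D / (p x + q x) ≤ p x * (T x - a) ^ 2 + q x * (T x - a') ^ 2 := by
      rwa [div_le_iff₀ hs]
    have h3 : D * (1 - (p x + q x) / 4) ≤ D / (p x + q x) := by
      rw [le_div_iff₀ hs]
      nlinarith [mul_nonneg hD0 (sq_nonneg ((p x + q x) / 2 - 1))]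
    linarith
  have hint : ENNReal.ofReal D ≤
      (∫⁻ x, ENNReal.ofReal (p x) * ENNReal.ofReal ((T x - a) ^ 2) ∂μ +
        ∫⁻ x, ENNReal.ofReal (q x) * ENNReal.ofReal ((T x - a') ^ 2) ∂μ) +
      ENNReal.ofReal (D / 2) := by
    have hD2 : ENNReal.ofReal (D / 2) = ∫⁻ x, (ENNReal.ofReal (D / 4) * ENNReal.ofReal (p x) +
        ENNReal.ofReal (D / 4) * ENNReal.ofReal (q x)) ∂μ := by
      rw [lintegral_add_left (by fun_prop), lintegral_const_mul _ (by fun_prop),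
        lintegral_const_mul _ (by fun_prop), hp1, hq1, mul_one,
        ← ENNReal.ofReal_add (by positivity) (by positivity)]
      congr 1
      ring
    rw [hD2, ← lintegral_add_left (by fun_prop), ← lintegral_add_left (by fun_prop)]
    calc ENNReal.ofReal D = ∫⁻ _, ENNReal.ofReal D ∂μ := by simp
      _ ≤ _ := by
        refine lintegral_mono fun x => ?_
        have := (hp0 x).le
        have := (hq0 x).le
        rw [← ENNReal.ofReal_mul (hp0 x).le, ← ENNReal.ofReal_mul (hq0 x).le,
          ← ENNReal.ofReal_mul (by positivity), ← ENNReal.ofReal_mul (by positivity),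
          ← ENNReal.ofReal_add (by positivity) (by positivity),
          ← ENNReal.ofReal_add (by positivity) (by positivity),
          ← ENNReal.ofReal_add (by positivity) (by positivity)]
        exact ENNReal.ofReal_le_ofReal (hpt x)
  have hfin : (a - a') ^ 2 / 2 * ρ = D - D / 2 := by rw [hD]; ring
  rw [hfin, ENNReal.ofReal_sub _ (by positivity)]
  exact tsub_le_iff_right.2 hint

theorem pi_withDensity_eq {ι : Type*} [Fintype ι] {Ω : ι → Type*} [∀ i, MeasurableSpace (Ω i)]
    {μ : ∀ i, Measure (Ω i)} [∀ i, IsProbabilityMeasure (μ i)] {f : ∀ i, Ω i → ℝ≥0∞}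
    (hf : ∀ i, Measurable (f i)) [∀ i, SigmaFinite ((μ i).withDensity (f i))] :
    Measure.pi (fun i => (μ i).withDensity (f i)) =
      (Measure.pi μ).withDensity fun x => ∏ i, f i (x i) := by
  refine Measure.pi_eq fun s hs => ?_
  have hind : iIndepFun (fun i (x : ∀ i, Ω i) => (s i).indicator (f i) (x i)) (Measure.pi μ) :=
    iIndepFun_pi fun i => ((hf i).indicator (hs i)).aemeasurable
  have hprod : ∀ x : ∀ i, Ω i, (Set.univ.pi s).indicator (fun x => ∏ i, f i (x i)) x
      = ∏ i, (s i).indicator (f i) (x i) := by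
    intro x
    by_cases hx : x ∈ Set.univ.pi s
    · rw [Set.indicator_of_mem hx]
      exact Finset.prod_congr rfl fun i _ => (Set.indicator_of_mem (hx i (Set.mem_univ i)) _).symm
    · rw [Set.indicator_of_notMem hx]
      obtain ⟨i, hi⟩ : ∃ i, x i ∉ s i := by simpa [Set.mem_pi] using hx
      exact (Finset.prod_eq_zero (Finset.mem_univ i) (Set.indicator_of_notMem hi _)).symm
  rw [withDensity_apply _ (MeasurableSet.univ_pi hs), ← lintegral_indicator (MeasurableSet.univ_pi hs)]
  simp_rw [hprod]
  rw [lintegral_prod_eq_prod_lintegral_of_indepFun Finset.univ _ hind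
    fun i => ((hf i).indicator (hs i)).comp (measurable_pi_apply i)]
  refine Finset.prod_congr rfl fun i _ => ?_
  rw [(measurePreserving_eval μ i).lintegral_comp ((hf i).indicator (hs i)),
    lintegral_indicator (hs i), withDensity_apply _ (hs i)]

theorem gaussianReal_add_eq_withDensity (m b : ℝ) {v : NNReal} (hv : v ≠ 0) :
    gaussianReal (m + b) v = (gaussianReal m v).withDensity fun y =>
      ENNReal.ofReal (Real.exp (b * (y - m) / v - b ^ 2 / (2 * v))) := by
  have hv' : (v : ℝ) ≠ 0 := by exact_mod_cast hv
  rw [gaussianReal_of_var_ne_zero _ hv, gaussianReal_of_var_ne_zero _ hv,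
    ← withDensity_mul _ (measurable_gaussianPDF m v) (by fun_prop)]
  congr 1
  ext y
  rw [Pi.mul_apply, gaussianPDF, gaussianPDF, ← ENNReal.ofReal_mul (gaussianPDFReal_nonneg _ _ _),
    gaussianPDFReal, gaussianPDFReal, mul_assoc (√(2 * Real.pi * v))⁻¹, ← Real.exp_add]
  congr 3
  field_simp
  ring

theorem pi_gaussianReal_add_eq_withDensity {ι : Type*} [Fintype ι] (m b : ι → ℝ) {v : NNReal}
    (hv : v ≠ 0) :
    Measure.pi (fun i => gaussianReal (m i + b i) v) =
      (Measure.pi fun i => gaussianReal (m i) v).withDensity fun y =>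
        ENNReal.ofReal (Real.exp (∑ i, (b i * (y i - m i) / v - b i ^ 2 / (2 * v)))) := by
  have hσ : ∀ i, SigmaFinite ((gaussianReal (m i) v).withDensity fun y =>
      ENNReal.ofReal (Real.exp (b i * (y - m i) / v - b i ^ 2 / (2 * v)))) := fun i => by
    rw [← gaussianReal_add_eq_withDensity _ _ hv]
    infer_instance
  simp_rw [fun i => gaussianReal_add_eq_withDensity (m i) (b i) hv]
  rw [pi_withDensity_eq fun i => by fun_prop]
  congr 1
  ext y
  rw [Real.exp_sum, ENNReal.ofReal_prod_of_nonneg fun i _ => (Real.exp_pos _).le]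

/-- The two-point bound for two Gaussian vectors with means `u`, `u'` and the same covariance
`v • 1`. -/
theorem two_point_sq_bound_gaussian {ι : Type*} [Fintype ι] (u u' : ι → ℝ) {v : NNReal}
    (hv : v ≠ 0) {T : (ι → ℝ) → ℝ} (hT : Measurable T) (a a' : ℝ) :
    ENNReal.ofReal ((a - a') ^ 2 / 2 * (1 - ∑ i, (u i - u' i) ^ 2 / (4 * v))) ≤
      ∫⁻ y, ENNReal.ofReal ((T y - a) ^ 2) ∂(Measure.pi fun i => gaussianReal (u i) v) +
      ∫⁻ y, ENNReal.ofReal ((T y - a') ^ 2) ∂(Measure.pi fun i => gaussianReal (u' i) v) := by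
  -- Relative to the Gaussian vector with the midpoint as its mean, the product of the two
  -- densities is constant.
  set m : ι → ℝ := fun i => (u i + u' i) / 2 with hm
  set b : ι → ℝ := fun i => (u i - u' i) / 2 with hb
  have hu : u = fun i => m i + b i := by ext i; simp only [hm, hb]; ring
  have hu' : u' = fun i => m i + -b i := by ext i; simp only [hm, hb]; ring
  have h1 := pi_gaussianReal_add_eq_withDensity m b hv
  have h2 := pi_gaussianReal_add_eq_withDensity m (fun i => -b i) hv
  have hP : IsProbabilityMeasure (Measure.pi fun i => gaussianReal (m i + b i) v) := inferInstance
  have hQ : IsProbabilityMeasure (Measure.pi fun i => gaussianReal (m i + -b i) v) := inferInstance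
  have hsum : Real.exp (-∑ i, (u i - u' i) ^ 2 / (4 * v)) ≥ 1 - ∑ i, (u i - u' i) ^ 2 / (4 * v) := by
    have := Real.add_one_le_exp (-∑ i, (u i - u' i) ^ 2 / (4 * v))
    linarith
  calc ENNReal.ofReal ((a - a') ^ 2 / 2 * (1 - ∑ i, (u i - u' i) ^ 2 / (4 * v)))
      ≤ ENNReal.ofReal ((a - a') ^ 2 / 2 * Real.exp (-∑ i, (u i - u' i) ^ 2 / (4 * v))) := by
        gcongr
    _ ≤ _ := by
        have hrw : ∀ f : (ι → ℝ) → ℝ≥0∞, ∫⁻ y, f y ∂(Measure.pi fun i => gaussianReal (u i) v)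
            = ∫⁻ y, f y ∂(Measure.pi fun i => gaussianReal (m i + b i) v) := fun f => by
          simp only [hu]
        have hrw' : ∀ f : (ι → ℝ) → ℝ≥0∞, ∫⁻ y, f y ∂(Measure.pi fun i => gaussianReal (u' i) v)
            = ∫⁻ y, f y ∂(Measure.pi fun i => gaussianReal (m i + -b i) v) := fun f => by
          simp only [hu']
        rw [hrw, hrw', h1, h2]
        rw [h1] at hP
        rw [h2] at hQ
        refine two_point_sq_bound (by fun_prop) (by fun_prop) (fun _ => Real.exp_pos _)
          (fun _ => Real.exp_pos _) (fun y => ?_) hP hQ hT a a'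
        rw [← Real.exp_add, ← Finset.sum_add_distrib, ← Finset.sum_neg_distrib]
        congr 1
        refine Finset.sum_congr rfl fun i _ => ?_
        simp only [hb]
        ring

end TwoPoint

/-! ### The sample in the rank-one submodel -/

instance isFiniteMeasure_leb01 : IsFiniteMeasure leb01 := by
  unfold leb01
  infer_instance

instance secondCountableTopology_L201 : SecondCountableTopology L201 :=
  have : Fact ((2 : ℝ≥0∞) ≠ ⊤) := ⟨by simp⟩
  inferInstance

theorem ofReal_integral_le_lintegral {Ω : Type*} [MeasurableSpace Ω] {μ : Measure Ω} {f : Ω → ℝ}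
    (hf : Integrable f μ) : ENNReal.ofReal (∫ x, f x ∂μ) ≤ ∫⁻ x, ENNReal.ofReal (f x) ∂μ := by
  calc ENNReal.ofReal (∫ x, f x ∂μ) ≤ ENNReal.ofReal (∫ x, max (f x) 0 ∂μ) :=
        ENNReal.ofReal_le_ofReal (integral_mono hf hf.pos_part fun x => le_max_left _ _)
    _ = ∫⁻ x, ENNReal.ofReal (max (f x) 0) ∂μ :=
        ofReal_integral_eq_lintegral_ofReal hf.pos_part
          (Filter.Eventually.of_forall fun x => le_max_right _ _)
    _ = _ := by simp

section Sample

open InnerProductSpace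

variable {μX με ν : Measure L201} [IsProbabilityMeasure μX] [IsProbabilityMeasure ν] {v : NNReal}
  {h : L201}

/-- In the rank-one submodel the output is `(⟪g, x⟫ + y) h + e` with `y` real Gaussian, independent
of `(x, e)`. -/
theorem modelLaw_rankOne (hε : με = (ν.prod (gaussianReal 0 v)).map fun p => p.2 • h + p.1)
    (g : L201) :
    modelLaw μX με (rankOne ℝ h g) = ((μX.prod ν).prod (gaussianReal 0 v)).map
      fun p => (p.1.1, (⟪g, p.1.1⟫ + p.2) • h + p.1.2) := by
  have h1 : μX.prod με = (μX.prod (ν.prod (gaussianReal 0 v))).map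
      (Prod.map id fun p : L201 × ℝ => p.2 • h + p.1) := by
    rw [← Measure.map_prod_map _ _ measurable_id (by fun_prop), Measure.map_id, hε]
  rw [modelLaw, h1, ← Measure.prodAssoc_prod, Measure.map_map (by fun_prop) (by fun_prop),
    Measure.map_map (by fun_prop) (by fun_prop)]
  congr 1
  ext p : 2
  · rfl
  · simp [MeasurableEquiv.prodAssoc, add_smul, add_assoc]

/-- Integration over the sample: given the inputs and the components of the noise that are
independent of the direction `h`, the sample is a function of a Gaussian vector. -/
theorem lintegral_pi_modelLaw (hε : με = (ν.prod (gaussianReal 0 v)).map fun p => p.2 • h + p.1)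
    (g : L201) (n : ℕ) {F : (Fin n → L201 × L201) → ℝ≥0∞} (hF : Measurable F) :
    ∫⁻ d, F d ∂(Measure.pi fun _ : Fin n => modelLaw μX με (rankOne ℝ h g)) =
      ∫⁻ z, ∫⁻ y, F (fun i => ((z i).1, (⟪g, (z i).1⟫ + y i) • h + (z i).2))
        ∂(Measure.pi fun _ : Fin n => gaussianReal 0 v) ∂(Measure.pi fun _ : Fin n => μX.prod ν) := by
  have hΦ : Measurable fun p : (L201 × L201) × ℝ => (p.1.1, (⟪g, p.1.1⟫ + p.2) • h + p.1.2) := by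
    fun_prop
  have : IsProbabilityMeasure (((μX.prod ν).prod (gaussianReal 0 v)).map
      fun p => (p.1.1, (⟪g, p.1.1⟫ + p.2) • h + p.1.2)) :=
    Measure.isProbabilityMeasure_map hΦ.aemeasurable
  rw [modelLaw_rankOne hε, ← Measure.pi_map_pi (fun _ => hΦ.aemeasurable),
    lintegral_map hF (by fun_prop)]
  have hmp := measurePreserving_arrowProdEquivProdArrow (L201 × L201) ℝ (Fin n)
    (fun _ => μX.prod ν) (fun _ => gaussianReal 0 v)
  have hH : Measurable fun p : (Fin n → L201 × L201) × (Fin n → ℝ) =>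
      F (fun i => ((p.1 i).1, (⟪g, (p.1 i).1⟫ + p.2 i) • h + (p.1 i).2)) :=
    hF.comp (by fun_prop)
  rw [← lintegral_prod _ hH.aemeasurable, ← hmp.lintegral_comp hH]
  rfl

/-- The two-point bound for the samples of two rank-one slope operators with the same range. Given
the inputs `x_i`, the samples are functions of Gaussian vectors with means `⟪g, x_i⟫` and
`⟪g', x_i⟫`; since the Gaussian bound is affine in their squared distance, only its mean matters, and
no exponential moment of the inputs is needed. -/
theorem two_point_sq_bound_modelLaw
    (hε : με = (ν.prod (gaussianReal 0 v)).map fun p => p.2 • h + p.1) (hv : v ≠ 0)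
    (hX : MemLp id 2 μX) (g g' : L201) (n : ℕ)
    (hgg : n * ∫ x, ⟪g - g', x⟫ ^ 2 ∂μX ≤ 2 * v)
    {T : (Fin n → L201 × L201) → ℝ} (hT : Measurable T) (a a' : ℝ) :
    ENNReal.ofReal ((a - a') ^ 2 / 4) ≤
      ∫⁻ d, ENNReal.ofReal ((T d - a) ^ 2)
        ∂(Measure.pi fun _ : Fin n => modelLaw μX με (rankOne ℝ h g)) +
      ∫⁻ d, ENNReal.ofReal ((T d - a') ^ 2)
        ∂(Measure.pi fun _ : Fin n => modelLaw μX με (rankOne ℝ h g')) := by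
  have hv' : (0 : ℝ) < v := by exact_mod_cast pos_iff_ne_zero.2 hv
  have hm : ∀ (g : L201) (a : ℝ), Measurable
      fun p : (Fin n → L201 × L201) × (Fin n → ℝ) => ENNReal.ofReal
        ((T (fun i => ((p.1 i).1, (⟪g, (p.1 i).1⟫ + p.2 i) • h + (p.1 i).2)) - a) ^ 2) := by
    intro g a
    have h1 : Measurable fun p : (Fin n → L201 × L201) × (Fin n → ℝ) =>
        T (fun i => ((p.1 i).1, (⟪g, (p.1 i).1⟫ + p.2 i) • h + (p.1 i).2)) :=
      hT.comp (by fun_prop)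
    fun_prop
  have hshift : ∀ (g : L201) (a : ℝ) (z : Fin n → L201 × L201),
      ∫⁻ y, ENNReal.ofReal ((T (fun i => ((z i).1, (⟪g, (z i).1⟫ + y i) • h + (z i).2)) - a) ^ 2)
        ∂(Measure.pi fun _ : Fin n => gaussianReal 0 v) =
      ∫⁻ y, ENNReal.ofReal ((T (fun i => ((z i).1, y i • h + (z i).2)) - a) ^ 2)
        ∂(Measure.pi fun i : Fin n => gaussianReal ⟪g, (z i).1⟫ v) := by
    intro g a z
    have h1 : (Measure.pi fun i : Fin n => gaussianReal ⟪g, (z i).1⟫ v) =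
        (Measure.pi fun _ : Fin n => gaussianReal 0 v).map fun y i => ⟪g, (z i).1⟫ + y i := by
      have : ∀ i, IsProbabilityMeasure ((gaussianReal 0 v).map fun y => ⟪g, (z i).1⟫ + y) :=
        fun i => Measure.isProbabilityMeasure_map (by fun_prop)
      rw [Measure.pi_map_pi (fun i => by fun_prop)]
      simp only [gaussianReal_map_const_add, zero_add]
    have h2 : Measurable fun y : Fin n → ℝ => T (fun i => ((z i).1, y i • h + (z i).2)) :=
      hT.comp (by fun_prop)
    rw [h1, lintegral_map (by fun_prop) (by fun_prop)]
  rw [lintegral_pi_modelLaw hε _ _ (by fun_prop), lintegral_pi_modelLaw hε _ _ (by fun_prop),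
    ← lintegral_add_left (Measurable.lintegral_prod_right (hm g a))]
  simp_rw [hshift]
  have hmp : ∀ i : Fin n, MeasurePreserving (fun z : Fin n → L201 × L201 => (z i).1)
      (Measure.pi fun _ : Fin n => μX.prod ν) μX := fun i =>
    measurePreserving_fst.comp (measurePreserving_eval (fun _ : Fin n => μX.prod ν) i)
  have hI : Integrable (fun x => ⟪g - g', x⟫ ^ 2) μX :=
    (memLp_two_iff_integrable_sq (by fun_prop)).1 (hX.const_inner (g - g'))
  have hI' : ∀ i : Fin n, Integrable (fun z : Fin n → L201 × L201 =>
      (⟪g, (z i).1⟫ - ⟪g', (z i).1⟫) ^ 2 / (4 * (v : ℝ))) (Measure.pi fun _ => μX.prod ν) := fun i => by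
    simp_rw [← inner_sub_left]
    exact ((hmp i).integrable_comp_of_integrable hI).div_const _
  have hIsum := integrable_finsetSum (μ := Measure.pi fun _ : Fin n => μX.prod ν) Finset.univ
    fun i _ => hI' i
  calc ENNReal.ofReal ((a - a') ^ 2 / 4)
      ≤ ENNReal.ofReal (∫ z, (a - a') ^ 2 / 2 *
          (1 - ∑ i, (⟪g, (z i).1⟫ - ⟪g', (z i).1⟫) ^ 2 / (4 * v))
            ∂(Measure.pi fun _ : Fin n => μX.prod ν)) := by
        refine ENNReal.ofReal_le_ofReal ?_
        rw [integral_const_mul, integral_sub (integrable_const _) hIsum,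
          integral_finsetSum _ fun i _ => hI' i]
        have h3 : ∀ i : Fin n, ∫ z, (⟪g, (z i).1⟫ - ⟪g', (z i).1⟫) ^ 2 / (4 * (v : ℝ))
            ∂(Measure.pi fun _ : Fin n => μX.prod ν) = (∫ x, ⟪g - g', x⟫ ^ 2 ∂μX) / (4 * v) := by
          intro i
          simp_rw [← inner_sub_left]
          rw [integral_div]
          congr 1
          conv_rhs => rw [← (hmp i).map_eq]
          rw [integral_map (hmp i).measurable.aemeasurable (by fun_prop)]
        simp_rw [h3]
        rw [Finset.sum_const, Finset.card_univ, Fintype.card_fin, nsmul_eq_mul, ← mul_div_assoc]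
        have h4 : (n * ∫ x, ⟪g - g', x⟫ ^ 2 ∂μX) / (4 * v) ≤ 1 / 2 := by
          rw [div_le_iff₀ (by positivity)]
          linarith
        simp only [integral_const, probReal_univ, smul_eq_mul, mul_one]
        nlinarith [sq_nonneg (a - a')]
    _ ≤ ∫⁻ z, ENNReal.ofReal ((a - a') ^ 2 / 2 *
          (1 - ∑ i, (⟪g, (z i).1⟫ - ⟪g', (z i).1⟫) ^ 2 / (4 * v)))
            ∂(Measure.pi fun _ : Fin n => μX.prod ν) :=
        ofReal_integral_le_lintegral (((integrable_const _).sub hIsum).const_mul _)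
    _ ≤ _ := by
        refine lintegral_mono fun z => ?_
        exact two_point_sq_bound_gaussian (fun i => ⟪g, (z i).1⟫) (fun i => ⟪g', (z i).1⟫) hv
          (T := fun y => T (fun i => ((z i).1, y i • h + (z i).2)))
          (hT.comp (by fun_prop)) a a'

end Sample

/-! ### Rank-one slope operators and the prediction risk -/

section RankOne

open InnerProductSpace

theorem isL2IntegralOperator_rankOne (g h : L201) : IsL2IntegralOperator (rankOne ℝ h g) := by
  refine ⟨fun p => g p.1 * h p.2, ?_, fun f => ?_⟩
  · have hsm : ∀ f : L201, StronglyMeasurable (f : ℝ → ℝ) := fun f => Lp.stronglyMeasurable f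
    have hsq : ∀ f : L201, Integrable (fun s => f s ^ 2) leb01 := fun f =>
      (memLp_two_iff_integrable_sq (hsm f).aestronglyMeasurable).1 (Lp.memLp f)
    have hm : AEStronglyMeasurable (fun p : ℝ × ℝ => g p.1 * h p.2) (leb01.prod leb01) :=
      (((hsm g).comp_measurable measurable_fst).mul
        ((hsm h).comp_measurable measurable_snd)).aestronglyMeasurable
    rw [memLp_two_iff_integrable_sq hm]
    simp_rw [mul_pow]
    exact (hsq g).mul_prod (hsq h)
  · rw [rankOne_apply]
    filter_upwards [Lp.coeFn_smul ⟪g, f⟫ h] with t ht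
    rw [ht, Pi.smul_apply, smul_eq_mul, L2.inner_def, ← integral_mul_const]
    refine integral_congr_ae (Filter.Eventually.of_forall fun s => ?_)
    simp only [RCLike.inner_apply, conj_trivial]
    ring

/-- The mean square of `T X` is at least the weighted sum of the squares of the coordinates
`⟪T φ_j, h⟫`: it is at least the second moment `⟪Γ T* h, T* h⟫` of `⟪h, T X⟫`, which is expanded in
the eigenbasis of `Γ`. -/
theorem sum_le_lintegral_enorm_apply_sq {μX : Measure L201} (hX : MemLp id 2 μX)
    (φ : HilbertBasis ℕ+ ℝ L201) {lam : ℕ+ → ℝ} (hlam : ∀ j, 0 < lam j)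
    (hΓ : ∀ j, covarianceOperator μX (φ j) = lam j • φ j) {h : L201} (hh : ‖h‖ = 1)
    (T : L201 →L[ℝ] L201) (J : Finset ℕ+) :
    ENNReal.ofReal (∑ j ∈ J, lam j * ⟪T (φ j), h⟫ ^ 2) ≤ ∫⁻ x, ‖T x‖ₑ ^ 2 ∂μX := by
  set u : L201 := ContinuousLinearMap.adjoint T h with hu
  have hux : ∀ x, ⟪u, x⟫ = ⟪h, T x⟫ := fun x => ContinuousLinearMap.adjoint_inner_left T x h
  have hsum : HasSum (fun j => lam j * ⟪T (φ j), h⟫ ^ 2) ⟪covarianceOperator μX u, u⟫ := by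
    refine (φ.hasSum_inner_mul_inner (covarianceOperator μX u) u).congr_fun fun j => ?_
    have h1 : ⟪covarianceOperator μX u, φ j⟫ = ⟪u, covarianceOperator μX (φ j)⟫ :=
      isPositive_covarianceOperator.1 u (φ j)
    rw [h1, hΓ, inner_smul_right, real_inner_comm u (φ j), hux, real_inner_comm]
    ring
  have hint : Integrable (fun x => ⟪u, x⟫ ^ 2) μX :=
    (memLp_two_iff_integrable_sq (hX.const_inner u).1).1 (hX.const_inner u)
  calc ENNReal.ofReal (∑ j ∈ J, lam j * ⟪T (φ j), h⟫ ^ 2)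
      ≤ ENNReal.ofReal (∫ x, ⟪u, x⟫ ^ 2 ∂μX) := by
        refine ENNReal.ofReal_le_ofReal ?_
        simp_rw [pow_two ⟪u, _⟫]
        rw [← covarianceOperator_inner hX]
        exact sum_le_hasSum J (fun j _ => mul_nonneg (hlam j).le (sq_nonneg _)) hsum
    _ = ∫⁻ x, ENNReal.ofReal (⟪u, x⟫ ^ 2) ∂μX :=
        ofReal_integral_eq_lintegral_ofReal hint (Filter.Eventually.of_forall fun x => sq_nonneg _)
    _ ≤ _ := by
        refine lintegral_mono fun x => ?_
        rw [← ofReal_norm, ← ENNReal.ofReal_pow (norm_nonneg _)]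
        refine ENNReal.ofReal_le_ofReal (sq_le_sq' ?_ ?_)
        · have := neg_le_of_abs_le (abs_real_inner_le_norm h (T x))
          rwa [hh, one_mul, ← hux] at this
        · have := real_inner_le_norm h (T x)
          rwa [hh, one_mul, ← hux] at this

/-- Only the row `r = 1` of the matrix of `S Γ^{1/2}` is nonzero, so the sequence `ψ` enters through
`ψ 1` alone. -/
theorem rankOne_comp_opSqrt_mem_ellipsoid {μX : Measure L201} (φ : HilbertBasis ℕ+ ℝ L201)
    {lam : ℕ+ → ℝ} (hlam : ∀ j, 0 < lam j)
    (hΓ : ∀ j, covarianceOperator μX (φ j) = lam j • φ j) {η ψ : ℕ+ → ℝ} {R δ : ℝ}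
    (hη : ∀ j, 0 < η j) (hψ : ∀ j, 0 < ψ j) {J : Finset ℕ+} (hJ : ψ 1 * δ ^ 2 * ∑ j ∈ J, η j ≤ R ^ 2)
    {g : L201} (hgJ : ∀ j ∈ J, lam j * ⟪g, φ j⟫ ^ 2 = δ ^ 2) (hg0 : ∀ j ∉ J, ⟪g, φ j⟫ = 0) :
    rankOne ℝ (φ 1) g ∘L opSqrt (covarianceOperator μX) ∈ ellipsoid φ η ψ R := by
  have hT : ∀ j, (rankOne ℝ (φ 1) g ∘L opSqrt (covarianceOperator μX)) (φ j)
      = (√(lam j) * ⟪g, φ j⟫) • φ 1 := fun j => by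
    rw [ContinuousLinearMap.comp_apply, (opSqrt_spec φ lam (fun j => (hlam j).le) hΓ).2 j,
      rankOne_apply, inner_smul_right]
  have horth : ∀ r, ⟪φ 1, φ r⟫ = if 1 = r then (1 : ℝ) else 0 :=
    fun r => orthonormal_iff_ite.1 φ.orthonormal 1 r
  refine ⟨⟨φ, ?_⟩, ?_⟩
  · refine summable_of_ne_finset_zero (s := J) fun j hj => ?_
    rw [hT, hg0 j hj]
    simp
  · have hr : ∀ j, ∑' r, ENNReal.ofReal (η j * ψ r *
        ⟪(rankOne ℝ (φ 1) g ∘L opSqrt (covarianceOperator μX)) (φ j), φ r⟫ ^ 2)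
        = ENNReal.ofReal (η j * ψ 1 * (lam j * ⟪g, φ j⟫ ^ 2)) := fun j => by
      rw [tsum_eq_single 1]
      · rw [hT, real_inner_smul_left, horth, if_pos rfl, mul_one, mul_pow, Real.sq_sqrt (hlam j).le]
      · intro r hr
        rw [hT, real_inner_smul_left, horth, if_neg (Ne.symm hr)]
        simp
    simp_rw [hr]
    rw [tsum_eq_sum (s := J) fun j hj => by rw [hg0 j hj]; simp,
      ← ENNReal.ofReal_sum_of_nonneg fun j _ => by
        have := hη j; have := hψ 1; have := hlam j; positivity]
    refine ENNReal.ofReal_le_ofReal (le_of_eq_of_le ?_ hJ)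
    rw [Finset.mul_sum]
    refine Finset.sum_congr rfl fun j hj => ?_
    rw [hgJ j hj]
    ring

end RankOne

/-! ### Averaging over the vertices of a hypercube -/

/-- **Averaging step of Assouad's lemma.** The vertices of the cube are the subsets `A` of `J`. If
the `j`-th losses at the two ends of each edge in direction `j` add up to at least `κ`, then a bound
`B` on the total loss at all vertices is at least `|J| κ / 2`. -/
theorem card_mul_le_of_forall_subset {ι : Type*} [DecidableEq ι] (J : Finset ι)
    (f : Finset ι → ι → ℝ≥0∞) (κ B : ℝ≥0∞)
    (hf : ∀ j ∈ J, ∀ A, j ∉ A → κ ≤ f A j + f (insert j A) j)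
    (hB : ∀ A ⊆ J, ∑ j ∈ J, f A j ≤ B) : J.card * κ ≤ 2 * B := by
  have hedge : ∀ j ∈ J, 2 ^ J.card * κ ≤ 2 * ∑ A ∈ J.powerset, f A j := by
    intro j hj
    have h1 : ∑ A ∈ J.powerset, f A j
        = ∑ A ∈ (J.erase j).powerset, (f A j + f (insert j A) j) := by
      conv_lhs => rw [← Finset.insert_erase hj]
      rw [Finset.sum_powerset_insert (Finset.notMem_erase j J), Finset.sum_add_distrib]
    have h2 : (J.erase j).powerset.card • κ ≤ ∑ A ∈ J.powerset, f A j := by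
      rw [h1]
      refine Finset.card_nsmul_le_sum _ _ _ fun A hA => hf j hj A fun hjA => ?_
      exact Finset.notMem_erase j J (Finset.mem_powerset.1 hA hjA)
    have h3 : J.card = (J.erase j).card + 1 := (Finset.card_erase_add_one hj).symm
    rw [nsmul_eq_mul, Finset.card_powerset] at h2
    push_cast at h2
    calc 2 ^ J.card * κ = 2 * (2 ^ (J.erase j).card * κ) := by rw [h3, pow_succ]; ring
      _ ≤ _ := by gcongr
  have h2 : (2 : ℝ≥0∞) ^ J.card ≠ 0 := by simp
  have h2' : (2 : ℝ≥0∞) ^ J.card ≠ ⊤ := by simp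
  rw [← ENNReal.mul_le_mul_iff_right h2 h2']
  calc (2 : ℝ≥0∞) ^ J.card * (J.card * κ) = ∑ j ∈ J, 2 ^ J.card * κ := by
        rw [Finset.sum_const, nsmul_eq_mul]; ring
    _ ≤ ∑ j ∈ J, 2 * ∑ A ∈ J.powerset, f A j := Finset.sum_le_sum hedge
    _ = 2 * ∑ A ∈ J.powerset, ∑ j ∈ J, f A j := by rw [← Finset.mul_sum, Finset.sum_comm]
    _ ≤ 2 * ∑ _A ∈ J.powerset, B := by
        gcongr with A hA
        exact hB A (Finset.mem_powerset.1 hA)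
    _ = 2 ^ J.card * (2 * B) := by
        rw [Finset.sum_const, nsmul_eq_mul, Finset.card_powerset]
        push_cast
        ring

section Hypercube

open InnerProductSpace

/-- The vertex `A` of a hypercube in the span of the `φ j`, `j ∈ J`: the coefficient of `φ j` is
`c j` for `j ∈ A` and `- c j` for the other `j ∈ J`. -/
noncomputable def hypercubeVertex (φ : HilbertBasis ℕ+ ℝ L201) (J : Finset ℕ+) (c : ℕ+ → ℝ) (A : Finset ℕ+) :
    L201 :=
  ∑ j ∈ J, (if j ∈ A then c j else -c j) • φ j

variable (φ : HilbertBasis ℕ+ ℝ L201) (J : Finset ℕ+) (c : ℕ+ → ℝ)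

theorem inner_hypercubeVertex (A : Finset ℕ+) (k : ℕ+) :
    ⟪hypercubeVertex φ J c A, φ k⟫ = if k ∈ J then (if k ∈ A then c k else -c k) else 0 := by
  have horth : ∀ j, ⟪φ j, φ k⟫ = if j = k then (1 : ℝ) else 0 :=
    fun j => orthonormal_iff_ite.1 φ.orthonormal j k
  rw [hypercubeVertex, sum_inner]
  simp_rw [real_inner_smul_left, horth, mul_ite, mul_one, mul_zero]
  rw [Finset.sum_ite_eq']

theorem hypercubeVertex_sub_insert {A : Finset ℕ+} {j : ℕ+} (hj : j ∈ J) (hjA : j ∉ A) :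
    hypercubeVertex φ J c A - hypercubeVertex φ J c (insert j A) = (-2 * c j) • φ j := by
  rw [hypercubeVertex, hypercubeVertex, ← Finset.sum_sub_distrib, Finset.sum_eq_single j]
  · rw [if_neg hjA, if_pos (Finset.mem_insert_self j A), ← sub_smul]
    congr 1
    ring
  · intro k _ hkj
    simp [hkj]
  · exact fun h => absurd hj h

/-- **Lower bound over a hypercube.** Let the noise split along `φ 1` with variance `v`. If the
cube with side `2 δ` (in the scale of `S Γ^{1/2}`) fits into the ellipsoid, and `n δ² ≤ v / 2`, so
that the two ends of an edge cannot be told apart from the sample, then the minimax risk is at least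
`|J| δ² / 2`. -/
theorem le_minimaxMSPE_of_hypercube {μX με ν : Measure L201} [IsProbabilityMeasure μX]
    [IsProbabilityMeasure ν] {v : NNReal} (hv : v ≠ 0)
    (hε : με = (ν.prod (gaussianReal 0 v)).map fun p => p.2 • φ 1 + p.1)
    (hX : MemLp id 2 μX) {lam : ℕ+ → ℝ} (hlam : ∀ j, 0 < lam j)
    (hΓ : ∀ j, covarianceOperator μX (φ j) = lam j • φ j) {η ψ : ℕ+ → ℝ} {R δ : ℝ}
    (hη : ∀ j, 0 < η j) (hψ : ∀ j, 0 < ψ j) (hJ : ψ 1 * δ ^ 2 * ∑ j ∈ J, η j ≤ R ^ 2) (n : ℕ)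
    (hn : 2 * (n * δ ^ 2) ≤ v) :
    ENNReal.ofReal (J.card * δ ^ 2 / 2) ≤ minimaxMSPE μX με n (ellipsoid φ η ψ R) := by
  have hφ1 : ‖φ 1‖ = 1 := φ.orthonormal.1 1
  -- Dividing by `√λ_j` makes all the entries of `S Γ^{1/2}` equal to `± δ`.
  set c : ℕ+ → ℝ := fun j => δ / √(lam j) with hc
  have hlc : ∀ j, lam j * c j ^ 2 = δ ^ 2 := fun j => by
    rw [hc, div_pow, Real.sq_sqrt (hlam j).le]
    have := (hlam j).ne'
    field_simp
  set g := hypercubeVertex φ J c with hg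
  refine le_iInf fun Shat => ?_
  set B : ℝ≥0∞ := ⨆ S ∈ {S : L201 →L[ℝ] L201 |
      IsL2IntegralOperator S ∧ S ∘L opSqrt (covarianceOperator μX) ∈ ellipsoid φ η ψ R},
    mspe μX με n Shat S with hB
  have hmem : ∀ A, rankOne ℝ (φ 1) (g A) ∘L opSqrt (covarianceOperator μX) ∈ ellipsoid φ η ψ R := by
    intro A
    refine rankOne_comp_opSqrt_mem_ellipsoid φ hlam hΓ hη hψ hJ (fun j hj => ?_) fun j hj => ?_
    · rw [hg, inner_hypercubeVertex, if_pos hj, ← hlc j]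
      split_ifs <;> ring
    · rw [hg, inner_hypercubeVertex, if_neg hj]
  have hle : ∀ A, mspe μX με n Shat (rankOne ℝ (φ 1) (g A)) ≤ B := fun A =>
    le_iSup₂ (f := fun S (_ : S ∈ {S : L201 →L[ℝ] L201 | IsL2IntegralOperator S ∧
      S ∘L opSqrt (covarianceOperator μX) ∈ ellipsoid φ η ψ R}) => mspe μX με n Shat S)
      _ ⟨isL2IntegralOperator_rankOne _ _, hmem A⟩
  let τ : ℕ+ → (Fin n → L201 × L201) → ℝ := fun j d => ⟪Shat.toFun d (φ j), φ 1⟫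
  have hτ : ∀ j, Measurable (τ j) := fun j => (Shat.measurable_apply (φ j)).inner_const
  let f : Finset ℕ+ → ℕ+ → ℝ≥0∞ := fun A j => ENNReal.ofReal (lam j) *
    ∫⁻ d, ENNReal.ofReal ((τ j d - ⟪g A, φ j⟫) ^ 2)
      ∂(Measure.pi fun _ : Fin n => modelLaw μX με (rankOne ℝ (φ 1) (g A)))
  have hrisk : ∀ A ⊆ J, ∑ j ∈ J, f A j ≤ B := by
    intro A _
    refine le_trans ?_ (hle A)
    rw [mspe]
    have h1 : ∑ j ∈ J, f A j = ∫⁻ d, ∑ j ∈ J, ENNReal.ofReal (lam j) *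
        ENNReal.ofReal ((τ j d - ⟪g A, φ j⟫) ^ 2)
          ∂(Measure.pi fun _ : Fin n => modelLaw μX με (rankOne ℝ (φ 1) (g A))) := by
      rw [lintegral_finsetSum _ fun j _ => by fun_prop]
      exact Finset.sum_congr rfl fun j _ => (lintegral_const_mul _ (by fun_prop)).symm
    rw [h1]
    refine lintegral_mono fun d => ?_
    refine le_of_eq_of_le ?_ (sum_le_lintegral_enorm_apply_sq hX φ hlam hΓ hφ1
      (Shat.toFun d - rankOne ℝ (φ 1) (g A)) J)
    rw [ENNReal.ofReal_sum_of_nonneg fun j _ => mul_nonneg (hlam j).le (sq_nonneg _)]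
    refine Finset.sum_congr rfl fun j _ => ?_
    rw [← ENNReal.ofReal_mul (hlam j).le, sub_apply, rankOne_apply, inner_sub_left,
      real_inner_smul_left, real_inner_self_eq_norm_sq, hφ1]
    simp only [τ, one_pow, mul_one]
  -- Across an edge, `⟪g, X⟫` changes by `2 c_j ⟪φ_j, X⟫`, whose second moment is
  -- `4 c_j² λ_j = 4 δ²`.
  have hedge : ∀ j ∈ J, ∀ A, j ∉ A → ENNReal.ofReal (δ ^ 2) ≤ f A j + f (insert j A) j := by
    intro j hj A hjA
    have hdiff : g A - g (insert j A) = (-2 * c j) • φ j := hypercubeVertex_sub_insert φ J c hj hjA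
    have hvar : ∫ x, ⟪g A - g (insert j A), x⟫ ^ 2 ∂μX = 4 * δ ^ 2 := by
      simp_rw [pow_two ⟪g A - _, _⟫]
      rw [← covarianceOperator_inner hX, hdiff, map_smul, hΓ, real_inner_smul_left,
        real_inner_smul_left, inner_smul_right, real_inner_self_eq_norm_sq, φ.orthonormal.1 j,
        ← hlc j]
      ring
    have h2 := two_point_sq_bound_modelLaw hε hv hX (g A) (g (insert j A)) n
      (by rw [hvar]; linarith) (hτ j) ⟪g A, φ j⟫ ⟪g (insert j A), φ j⟫
    have h3 : ⟪g A, φ j⟫ - ⟪g (insert j A), φ j⟫ = -2 * c j := by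
      rw [← inner_sub_left, hdiff, real_inner_smul_left, real_inner_self_eq_norm_sq,
        φ.orthonormal.1 j]
      ring
    calc ENNReal.ofReal (δ ^ 2) = ENNReal.ofReal (lam j) *
          ENNReal.ofReal ((⟪g A, φ j⟫ - ⟪g (insert j A), φ j⟫) ^ 2 / 4) := by
          rw [h3, ← ENNReal.ofReal_mul (hlam j).le, ← hlc j]
          congr 1
          ring
      _ ≤ _ := by
          simp only [f]
          rw [← mul_add]
          gcongr
  have hfin := card_mul_le_of_forall_subset J f _ B hedge hrisk
  have h4 : ENNReal.ofReal (J.card * δ ^ 2 / 2) = (J.card * ENNReal.ofReal (δ ^ 2)) / 2 := by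
    rw [ENNReal.ofReal_div_of_pos (by norm_num), ENNReal.ofReal_mul (by positivity)]
    simp
  rw [h4]
  refine ENNReal.div_le_of_le_mul ?_
  rwa [mul_comm B]

end Hypercube

/-! ### The balance between variance and bias -/

/-- A regularity sequence is equivalent to its model sequence `j ^ γ` or `exp (j ^ γ)`, which is
monotone and at least `1`. -/
theorem IsRegularitySeq.exists_monotone {γ : ℝ} (hγ : 0 < γ) {a : ℕ+ → ℝ}
    (ha : IsRegularitySeq γ a) :
    ∃ (c : ℝ) (κ : ℕ+ → ℝ), 1 ≤ c ∧ Monotone κ ∧ (∀ j, 1 ≤ κ j) ∧ (∀ j, κ j ≤ c * a j) ∧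
      ∀ j, a j ≤ c * κ j := by
  have hmono : Monotone fun j : ℕ+ => ((j : ℕ) : ℝ) ^ γ := fun i j hij =>
    Real.rpow_le_rpow (by positivity) (by exact_mod_cast hij) hγ.le
  have hone : ∀ j : ℕ+, (1 : ℝ) ≤ ((j : ℕ) : ℝ) := fun j => Nat.one_le_cast.2 j.pos
  have hflip : ∀ {κ : ℕ+ → ℝ} {c : ℝ}, 1 ≤ c → (∀ j, c⁻¹ * a j ≤ κ j ∧ κ j ≤ c * a j) →
      ∀ j, a j ≤ c * κ j := fun hc h j => by
    have := (h j).1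
    rwa [inv_mul_le_iff₀ (by linarith)] at this
  rcases ha with ⟨c, hc, h⟩ | ⟨c, hc, h⟩
  · exact ⟨c, _, hc, hmono, fun j => Real.one_le_rpow (hone j) hγ.le, fun j => (h j).2, hflip hc h⟩
  · exact ⟨c, _, hc, fun i j hij => Real.exp_le_exp.2 (hmono hij),
      fun j => Real.one_le_exp (by positivity), fun j => (h j).2, hflip hc h⟩

/-- Let `m` be the first dimension at which `m κ_m` reaches the sample size `n`, and `M = m - 1` the
one before it. Then `m ≤ 2 M`, unless `m = 1`; in that case `M = 1` is taken, at the price of the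
factor `κ 1`. -/
theorem exists_balanced_dimension {κ : ℕ+ → ℝ} (hκ1 : ∀ j, 1 ≤ κ j) {n : ℕ} (hn : 1 ≤ n) :
    ∃ M m : ℕ+, ((m : ℕ) : ℝ) ≤ 2 * ((M : ℕ) : ℝ) ∧ (n : ℝ) ≤ ((m : ℕ) : ℝ) * κ m ∧
      ((M : ℕ) : ℝ) * κ M ≤ κ 1 * n := by
  have hn1 : (1 : ℝ) ≤ n := by exact_mod_cast hn
  have hex : ∃ m : ℕ+, (n : ℝ) ≤ ((m : ℕ) : ℝ) * κ m := by
    refine ⟨⟨n, hn⟩, ?_⟩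
    have := hκ1 ⟨n, hn⟩
    simp only [PNat.mk_coe]
    nlinarith
  classical
  set m := PNat.find hex with hm
  have hmspec : (n : ℝ) ≤ ((m : ℕ) : ℝ) * κ m := PNat.find_spec hex
  by_cases hm1 : m = 1
  · refine ⟨1, m, ?_, hmspec, ?_⟩
    · rw [hm1]; norm_num
    · have := hκ1 1
      simp only [PNat.one_coe, Nat.cast_one, one_mul]
      nlinarith
  · obtain ⟨M, hM⟩ := PNat.exists_eq_succ_of_ne_one hm1
    have hMlt : M < m := by rw [hM]; exact PNat.lt_add_right M 1
    have hMn : ((M : ℕ) : ℝ) * κ M < n := not_le.1 (PNat.find_min hex hMlt)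
    refine ⟨M, m, ?_, hmspec, ?_⟩
    · have h1 : (1 : ℝ) ≤ ((M : ℕ) : ℝ) := Nat.one_le_cast.2 M.pos
      rw [hM]
      push_cast
      linarith
    · have := hκ1 1
      nlinarith

/-- The default value `0` of `opSqrt` is excluded since it does not take the nonzero value `h`. -/
theorem exists_splitting_of_opSqrt_eq {με : Measure L201} [IsGaussian με] (hε0 : ∫ e, e ∂με = 0)
    {h w : L201} (hh : h ≠ 0) (hw : opSqrt (covarianceOperator με) w = h) {σ₁ : ℝ}
    (hσ₁ : 0 < σ₁) (hwσ : σ₁ * ‖w‖ ^ 2 ≤ 1) :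
    ∃ (v : NNReal) (ν : Measure L201), IsProbabilityMeasure ν ∧ σ₁ ≤ v ∧
      με = (ν.prod (gaussianReal 0 v)).map fun p => p.2 • h + p.1 := by
  have hsqrt : IsPosSqrt (covarianceOperator με) (opSqrt (covarianceOperator με)) := by
    by_cases hex : ∃ G, IsPosSqrt (covarianceOperator με) G
    · rw [opSqrt, dif_pos hex]
      exact hex.choose_spec
    · rw [opSqrt, dif_neg hex] at hw
      exact absurd hw.symm hh
  obtain ⟨v, ν, hν, hv, hsplit⟩ :=
    exists_gaussian_splitting με hε0 hsqrt.1 hsqrt.2 (w := w) (by rwa [hw])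
  refine ⟨v, ν, hν, ?_, by rwa [hw] at hsplit⟩
  have hv0 : (0 : ℝ) ≤ v := v.2
  nlinarith [mul_le_mul_of_nonneg_left hv hσ₁.le, mul_le_mul_of_nonneg_left hwσ hv0]

theorem mainTheorem3 (α β R σsq σ₁ : ℝ) (hα : 0 < α) (hβ : 0 < β) (hR : 0 < R) (hσ₁ : 0 < σ₁)
    (η ψ : ℕ+ → ℝ) (hη : IsRegularitySeq α η) (hψ : IsRegularitySeq β ψ) :
    ∃ C : ℝ, 0 < C ∧
      ∀ (μX με : Measure L201) [IsProbabilityMeasure μX] [IsGaussian με],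
        MemLp id 2 μX → ∫ x, x ∂μX = 0 →
        ∫ e, e ∂με = 0 → ∫ e, ‖e‖ ^ 2 ∂με = σsq →
        ∀ (φ : HilbertBasis ℕ+ ℝ L201) (lam : ℕ+ → ℝ),
          Antitone lam → (∀ j, 0 < lam j) → (∀ j, covarianceOperator μX (φ j) = lam j • φ j) →
          (∃ w : L201, opSqrt (covarianceOperator με) w = φ 1 ∧ σ₁ * ‖w‖ ^ 2 ≤ 1) →
          ∀ n : ℕ, 1 ≤ n →
            ENNReal.ofReal (C * ⨅ m : ℕ+, (σsq * ((m : ℕ) : ℝ) / (n : ℝ) + 3 / η m)) ≤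
              minimaxMSPE μX με n (ellipsoid φ η ψ R) := by
  obtain ⟨c, κ, hc, hκmono, hκ1, hκη, hηκ⟩ := hη.exists_monotone hα
  obtain ⟨c', κ', hc', -, hκ1', hκψ, -⟩ := hψ.exists_monotone hβ
  have hη0 : ∀ j, 0 < η j := fun j => by
    have h1 := hκη j
    have h2 := hκ1 j
    exact pos_of_mul_pos_right (by linarith : 0 < c * η j) (by linarith)
  have hψ0 : ∀ j, 0 < ψ j := fun j => by
    have h1 := hκψ j
    have h2 := hκ1' j
    exact pos_of_mul_pos_right (by linarith : 0 < c' * ψ j) (by linarith)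
  have hc0 : 0 < c := by linarith
  have hκ0 : ∀ j, 0 < κ j := fun j => by linarith [hκ1 j]
  have hψ1 := hψ0 1
  have hκ11 := hκ0 1
  -- `b M / n` bounds the risk from below and `2 (σ² + 3 c) M / n` bounds the infimum from above,
  -- at the balanced dimension `M`.
  set b : ℝ := min (σ₁ / 4) (R ^ 2 / (2 * ψ 1 * c * κ 1)) with hb
  have hb0 : 0 < b := lt_min (by positivity) (by positivity)
  refine ⟨b / (2 * (|σsq| + 3 * c)), by positivity, ?_⟩
  intro μX με _ _ hX _ hε0 hσ φ lam _ hlam hΓ hw n hn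
  obtain ⟨w, hw, hwσ⟩ := hw
  have hσ0 : 0 ≤ σsq := by
    rw [← hσ]
    exact integral_nonneg fun e => by positivity
  rw [abs_of_nonneg hσ0]
  have hφ1 : φ 1 ≠ 0 := φ.orthonormal.ne_zero 1
  obtain ⟨v, ν, hν, hv, hsplit⟩ := exists_splitting_of_opSqrt_eq hε0 hφ1 hw hσ₁ hwσ
  have hv0 : v ≠ 0 := by
    rintro rfl
    simp only [NNReal.coe_zero] at hv
    linarith
  obtain ⟨M, m, hmM, hnm, hMn⟩ := exists_balanced_dimension hκ1 hn
  have hn0 : (0 : ℝ) < n := by exact_mod_cast hn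
  have hM0 : (0 : ℝ) < ((M : ℕ) : ℝ) := by exact_mod_cast M.pos
  have hm0 : (0 : ℝ) < ((m : ℕ) : ℝ) := by exact_mod_cast m.pos
  have hκM := hκ0 M
  -- The squared half side of the hypercube.
  set D : ℝ := 2 * b / n with hD
  have hDδ : √D ^ 2 = D := Real.sq_sqrt (by positivity)
  have hcard : (Finset.Icc 1 M).card = (M : ℕ) := by simp
  have hlow := le_minimaxMSPE_of_hypercube φ (Finset.Icc 1 M) hv0 hsplit hX hlam hΓ hη0 hψ0
    (R := R) (δ := √D) ?_ n ?_
  · refine le_trans (ENNReal.ofReal_le_ofReal ?_) hlow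
    rw [hDδ, hcard, hD]
    have hinf : ⨅ m : ℕ+, (σsq * ((m : ℕ) : ℝ) / (n : ℝ) + 3 / η m)
        ≤ σsq * ((m : ℕ) : ℝ) / (n : ℝ) + 3 / η m :=
      ciInf_le ⟨0, by
        rintro _ ⟨k, rfl⟩
        have := hη0 k
        positivity⟩ m
    have hηm : 3 / η m ≤ 3 * c * (((m : ℕ) : ℝ) / n) := by
      have h1 : 1 ≤ ((m : ℕ) : ℝ) * (c * η m) / n := by
        rw [one_le_div hn0]
        exact hnm.trans (mul_le_mul_of_nonneg_left (hκη m) hm0.le)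
      rw [div_le_iff₀ (hη0 m)]
      calc (3 : ℝ) ≤ 3 * (((m : ℕ) : ℝ) * (c * η m) / n) := by linarith
        _ = _ := by ring
    have hup : ⨅ m : ℕ+, (σsq * ((m : ℕ) : ℝ) / (n : ℝ) + 3 / η m)
        ≤ 2 * (σsq + 3 * c) * (((M : ℕ) : ℝ) / n) := by
      have h2 : ((m : ℕ) : ℝ) / n ≤ 2 * (((M : ℕ) : ℝ) / n) := by
        rw [← mul_div_assoc]
        gcongr
      calc _ ≤ σsq * ((m : ℕ) : ℝ) / (n : ℝ) + 3 / η m := hinf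
        _ ≤ (σsq + 3 * c) * (((m : ℕ) : ℝ) / n) := by
            rw [mul_div_assoc]
            linarith
        _ ≤ (σsq + 3 * c) * (2 * (((M : ℕ) : ℝ) / n)) := by gcongr
        _ = _ := by ring
    calc _ ≤ b / (2 * (σsq + 3 * c)) * (2 * (σsq + 3 * c) * (((M : ℕ) : ℝ) / n)) := by gcongr
      _ = _ := by
        have : 2 * (σsq + 3 * c) ≠ 0 := by positivity
        field_simp
  · rw [hDδ]
    have hsum : ∑ j ∈ Finset.Icc 1 M, η j ≤ ((M : ℕ) : ℝ) * (c * κ M) := by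
      calc ∑ j ∈ Finset.Icc 1 M, η j ≤ ∑ j ∈ Finset.Icc 1 M, c * κ M :=
            Finset.sum_le_sum fun j hj => (hηκ j).trans
              (mul_le_mul_of_nonneg_left (hκmono (Finset.mem_Icc.1 hj).2) hc0.le)
        _ = _ := by rw [Finset.sum_const, hcard, nsmul_eq_mul]
    have hb2 : b * (2 * ψ 1 * c * κ 1) ≤ R ^ 2 := by
      rw [← le_div_iff₀ (by positivity)]
      exact min_le_right _ _
    calc ψ 1 * D * ∑ j ∈ Finset.Icc 1 M, η j ≤ ψ 1 * D * (((M : ℕ) : ℝ) * (c * κ M)) := by gcongr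
      _ = ψ 1 * D * c * (((M : ℕ) : ℝ) * κ M) := by ring
      _ ≤ ψ 1 * D * c * (κ 1 * n) := by gcongr
      _ = b * (2 * ψ 1 * c * κ 1) := by rw [hD]; field_simp
      _ ≤ R ^ 2 := hb2
  · rw [hDδ, hD]
    have hb1 : b ≤ σ₁ / 4 := min_le_left _ _
    have : 2 * (n * (2 * b / n)) = 4 * b := by field_simp; ring
    rw [this]
    linarith
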